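/- Let $G=(S,E)$ be a finite simple graph, $K\subset\mathbb{C}$ a field and $c\ge 1$ an integer. Let $\mathfrak{f}^K(S)$ be the free Lie algebra over $K$ generated by $S$, let $\mathfrak{g}_G^K$ be its quotient by the ideal generated by all brackets $[\alpha,\beta]$ with $\alpha,\beta\in S$ and $\{\alpha,\beta\}\notin E$, and let $\mathfrak{n}_{G,c}^K=\mathfrak{g}_G^K/\gamma_{c+1}(\mathfrak{g}_G^K)$, where $\gamma_1(\mathfrak{g})=\mathfrak{g}$ and $\gamma_{i+1}(\mathfrak{g})=[\mathfrak{g},\gamma_i(\mathfrak{g})]$. Let $f_\Psi$ be a vertex-diagonal automorphism of $\mathfrak{n}_{G,c}^K$ determined by a map $\Psi:S\to K$, that is, a Lie algebra automorphism with $f_\Psi(\alpha)=\Psi(\alpha)\alpha$ for every $\alpha\in S$. For $e:S\to\mathbb{Z}^{\ge 0}$ write $\operatorname{supp}(e)=\{\alpha\in S\mid e(\alpha)\ne 0\}$, and call it connected if the subgraph of $G$ induced on it is connected. Then the set of eigenvalues of $f_\Psi$ is \[ \Psi(S)\;\cup\;\Bigl\{\prod_{\alpha\in S}\Psi(\alpha)^{e(\alpha)}\;\Big|\;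 e:S\to\mathbb{Z}^{\ge 0},\ \operatorname{supp}(e)\text{ is connected},\ |\operatorname{supp}(e)|\ge 2,\ \sum_{\alpha\in S}e(\alpha)\le c\Bigr\}. \] -/

import Mathlib

noncomputable section

namespace GraphLie

/-- The ideal of the free Lie algebra on the vertex set `S` generated by the brackets `[α, β]` of
all pairs of vertices that do not form an edge. -/
abbrev nonEdgeIdeal (K : Type*) [Field K] {S : Type*} (G : SimpleGraph S) :
    LieIdeal K (FreeLieAlgebra K S) :=
  LieSubmodule.lieSpan K (FreeLieAlgebra K S)
    {x | ∃ α β : S, ¬ G.Adj α β ∧ x = ⁅FreeLieAlgebra.of K α, FreeLieAlgebra.of K β⁆}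

/-- The free partially commutative Lie algebra `𝔤_G^K` of the graph `G`. -/
abbrev FreePartComm (K : Type*) [Field K] {S : Type*} (G : SimpleGraph S) : Type _ :=
  FreeLieAlgebra K S ⧸ nonEdgeIdeal K G

/-- The term `γ_{c+1}(𝔤)` of the lower central series of `𝔤 = 𝔤_G^K`, where `γ_1(𝔤) = 𝔤` and
`γ_{i+1}(𝔤) = [𝔤, γ_i(𝔤)]`. Mathlib's indexing starts at `0` instead of `1`. -/
abbrev gammaSucc (K : Type*) [Field K] {S : Type*} (G : SimpleGraph S) (c : ℕ) :
    LieIdeal K (FreePartComm K G) :=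
  LieModule.lowerCentralSeries K (FreePartComm K G) (FreePartComm K G) c

/-- The `c`-step nilpotent Lie algebra `𝔫_{G,c}^K = 𝔤_G^K / γ_{c+1}(𝔤_G^K)` of the graph `G`. -/
abbrev NilpotentLie (K : Type*) [Field K] {S : Type*} (G : SimpleGraph S) (c : ℕ) : Type _ :=
  FreePartComm K G ⧸ gammaSucc K G c

/-- The element of `𝔫_{G,c}^K` given by a vertex of `G`. -/
def vertex (K : Type*) [Field K] {S : Type*} (G : SimpleGraph S) (c : ℕ) (α : S) :
    NilpotentLie K G c :=
  LieSubmodule.Quotient.mk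
    (LieSubmodule.Quotient.mk (FreeLieAlgebra.of K α) : FreePartComm K G)

/-- `f` is the vertex-diagonal automorphism of `𝔫_{G,c}^K` determined by `Ψ : S → K`. -/
def IsVertexDiagonal {K : Type*} [Field K] {S : Type*} {G : SimpleGraph S} {c : ℕ}
    (f : NilpotentLie K G c ≃ₗ⁅K⁆ NilpotentLie K G c) (Ψ : S → K) : Prop :=
  ∀ α : S, f (vertex K G c α) = Ψ α • vertex K G c α

theorem exists_quotient_lift {K L L' : Type*} [Field K] [LieRing L] [LieAlgebra K L] [LieRing L']
    [LieAlgebra K L'] (I : LieIdeal K L) (g : L →ₗ⁅K⁆ L') (h : ∀ x ∈ I, g x = 0) :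
    ∃ g' : (L ⧸ I) →ₗ⁅K⁆ L', ∀ x, g' (LieSubmodule.Quotient.mk x) = g x := by
  refine ⟨{ I.toSubmodule.liftQ (g : L →ₗ[K] L') (fun x hx => h x hx) with
    map_lie' := ?_ }, fun x => rfl⟩
  intro x y
  induction x using Submodule.Quotient.induction_on
  induction y using Submodule.Quotient.induction_on
  exact g.map_lie _ _

theorem hom_ext {K : Type*} [Field K] {S : Type*} {G : SimpleGraph S} {c : ℕ} {L : Type*}
    [LieRing L] [LieAlgebra K L] (f g : NilpotentLie K G c →ₗ⁅K⁆ L)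
    (h : ∀ α, f (vertex K G c α) = g (vertex K G c α)) : f = g := by
  let π₁ : FreeLieAlgebra K S →ₗ⁅K⁆ FreePartComm K G :=
    { (nonEdgeIdeal K G).toSubmodule.mkQ with map_lie' := fun {_ _} => rfl }
  let π₂ : FreePartComm K G →ₗ⁅K⁆ NilpotentLie K G c :=
    { (gammaSucc K G c).toSubmodule.mkQ with map_lie' := fun {_ _} => rfl }
  have key : (f.comp π₂).comp π₁ = (g.comp π₂).comp π₁ := FreeLieAlgebra.hom_ext h
  ext x
  induction x using Submodule.Quotient.induction_on with | _ x
  induction x using Submodule.Quotient.induction_on with | _ x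
  exact LieHom.congr_fun key x

theorem exists_end (K : Type*) [Field K] {S : Type*} (G : SimpleGraph S) (c : ℕ) (Ψ : S → K) :
    ∃ f : NilpotentLie K G c →ₗ⁅K⁆ NilpotentLie K G c,
      ∀ α, f (vertex K G c α) = Ψ α • vertex K G c α := by
  let π₁ : FreeLieAlgebra K S →ₗ⁅K⁆ FreePartComm K G :=
    { (nonEdgeIdeal K G).toSubmodule.mkQ with map_lie' := fun {_ _} => rfl }
  let π₂ : FreePartComm K G →ₗ⁅K⁆ NilpotentLie K G c :=
    { (gammaSucc K G c).toSubmodule.mkQ with map_lie' := fun {_ _} => rfl }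
  let f₀ : FreeLieAlgebra K S →ₗ⁅K⁆ FreePartComm K G :=
    FreeLieAlgebra.lift K (fun α => Ψ α • π₁ (FreeLieAlgebra.of K α))
  have hf₀ : ∀ α, f₀ (FreeLieAlgebra.of K α) = Ψ α • π₁ (FreeLieAlgebra.of K α) :=
    fun α => FreeLieAlgebra.lift_of_apply _ α
  have h₀ : nonEdgeIdeal K G ≤ f₀.ker := by
    rw [LieSubmodule.lieSpan_le]
    rintro _ ⟨α, β, hab, rfl⟩
    rw [SetLike.mem_coe, LieHom.mem_ker, LieHom.map_lie, hf₀, hf₀, smul_lie, lie_smul,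
      ← LieHom.map_lie]
    have : π₁ ⁅FreeLieAlgebra.of K α, FreeLieAlgebra.of K β⁆ = 0 :=
      (Submodule.Quotient.mk_eq_zero _).2
        (LieSubmodule.subset_lieSpan ⟨α, β, hab, rfl⟩)
    rw [this, smul_zero, smul_zero]
  obtain ⟨f₁, hf₁⟩ := exists_quotient_lift (nonEdgeIdeal K G) f₀
    (fun x hx => LieHom.mem_ker.1 (h₀ hx))
  obtain ⟨f₂, hf₂⟩ := exists_quotient_lift (gammaSucc K G c) (π₂.comp f₁) (by
    intro x hx
    have h1 : f₁ x ∈ gammaSucc K G c :=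
      LieIdeal.map_lowerCentralSeries_le c (f := f₁) (LieIdeal.mem_map hx)
    exact (Submodule.Quotient.mk_eq_zero _).2 h1)
  refine ⟨f₂, fun α => ?_⟩
  have h2 : f₂ (vertex K G c α) = π₂ (f₁ (LieSubmodule.Quotient.mk (FreeLieAlgebra.of K α))) :=
    hf₂ _
  rw [h2, hf₁, hf₀, map_smul]
  rfl

/-- For every `Ψ : S → K \ {0}` there is exactly one vertex-diagonal automorphism of `𝔫_{G,c}^K`
determined by `Ψ`. -/
theorem existsUnique_isVertexDiagonal {K : Type*} [Field K] {S : Type*} (G : SimpleGraph S)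
    (c : ℕ) (Ψ : S → K) (hΨ : ∀ α, Ψ α ≠ 0) :
    ∃! f : NilpotentLie K G c ≃ₗ⁅K⁆ NilpotentLie K G c, IsVertexDiagonal f Ψ := by
  obtain ⟨f, hf⟩ := exists_end K G c Ψ
  obtain ⟨g, hg⟩ := exists_end K G c (fun α => (Ψ α)⁻¹)
  have hgf : g.comp f = LieHom.id := hom_ext _ _ (fun α => by
    rw [LieHom.comp_apply, hf, map_smul, hg, smul_smul, mul_inv_cancel₀ (hΨ α), one_smul]; rfl)
  have hfg : f.comp g = LieHom.id := hom_ext _ _ (fun α => by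
    rw [LieHom.comp_apply, hg, map_smul, hf, smul_smul, inv_mul_cancel₀ (hΨ α), one_smul]; rfl)
  refine ⟨{ f with
    invFun := g
    left_inv := LieHom.congr_fun hgf
    right_inv := LieHom.congr_fun hfg }, hf, fun f' hf' => ?_⟩
  have : (f' : NilpotentLie K G c →ₗ⁅K⁆ NilpotentLie K G c) = f :=
    hom_ext _ _ (fun α => (hf' α).trans (hf α).symm)
  ext x
  exact LieHom.congr_fun this x

end GraphLie

end

/-!
Call an iterated bracket `[α₁, [α₂, […, αₖ]]]` of vertices a bracket monomial; its multidegree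
`e : S → ℕ` counts how often every vertex occurs. A vertex-diagonal endomorphism `f_Ψ` multiplies a
bracket monomial of multidegree `e` by `∏ Ψ(α)^e(α)`. Bracket monomials span `𝔫_{G,c}`
(`span_isBracketMonomial_eq_top`), and eigenspaces to different eigenvalues are independent, so the
eigenvalues of `f_Ψ` are exactly these products for the multidegrees of the nonzero bracket
monomials. It remains to determine those multidegrees.

If a bracket monomial is nonzero, then in each step the new vertex is adjacent to a vertex used
before, because otherwise it commutes with all of them. Hence the support of the multidegree is
connected, and it has at least two vertices unless the monomial is a single vertex
(`IsBracketMonomial.support_connected`). The total degree is at most `c`, since monomials of larger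
degree lie in `γ_{c+1}`.

Conversely, let `e` have total degree at most `c` and connected support with at least two vertices.
The Lie algebra `𝔤_G` acts on functions `F : (S → ℕ) → K` by weighted shifts
`(α F)(d) = φ_α(d) F(d + 1_α)` as soon as `φ_α(d)` does not depend on the values of `d` at
non-neighbours of `α` (`exists_shift_representation`). Elements of `γ_{c+1}` lower the total degree
by more than `c`, so an element `x` of `𝔤_G` with `(x F)(0) = s F(e)` for all `F`, where `s ≠ 0`,
does not lie in `γ_{c+1}` (`toNilpotent_ne_zero`). To find such a bracket monomial, choose an edge
`a b` in the support of `e` and weights `φ` (`edgeWeight`) with values `0` and `1` which allow the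
letter `a` only before `b` and any other letter only after one of its neighbours. For
`ad(a)^m b` with `m = e(a)`, only the word `a^m b` contributes to `(x F)(0)`
(`exists_monomial_ad_pow`). Bracketing with a further vertex `α ≠ a` adjacent to the support leaves
a single contributing word, since no word may start with `α` (`exists_monomial_add_single`). As the
support of `e` is connected, such steps lead to `e` (`exists_monomial_of_connected`).
-/

noncomputable section

namespace GraphLie

/-! ### Bracket monomials -/

/-- `IsBracketMonomial v e x` says that `x` is an iterated bracket
`[v α₁, [v α₂, […, v αₖ]]]`, where `k ≥ 1` and every `α` occurs exactly `e α` times among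
`α₁, …, αₖ`. -/
inductive IsBracketMonomial {S L : Type*} [DecidableEq S] [LieRing L] (v : S → L) :
    (S → ℕ) → L → Prop
  | gen (α : S) : IsBracketMonomial v (Pi.single α 1) (v α)
  | ad (α : S) {e : S → ℕ} {x : L} (hx : IsBracketMonomial v e x) :
      IsBracketMonomial v (e + Pi.single α 1) ⁅v α, x⁆

section Monomials

variable {K : Type*} [Field K] {S : Type*} [DecidableEq S]
variable {L L' : Type*} [LieRing L] [LieAlgebra K L] [LieRing L'] [LieAlgebra K L']
variable {v : S → L} {e : S → ℕ} {x : L}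

theorem IsBracketMonomial.map (g : L →ₗ⁅K⁆ L') (h : IsBracketMonomial v e x) :
    IsBracketMonomial (fun α => g (v α)) e (g x) := by
  induction h with
  | gen α => exact .gen α
  | ad α _ ih => rw [LieHom.map_lie]; exact .ad α ih

theorem prod_pow_single [Fintype S] (Ψ : S → K) (α : S) :
    ∏ β, Ψ β ^ (Pi.single α 1 : S → ℕ) β = Ψ α := by
  rw [Finset.prod_eq_single α] <;> simp +contextual

theorem IsBracketMonomial.apply_eq_prod_smul [Fintype S] (h : IsBracketMonomial v e x)
    {f : L →ₗ⁅K⁆ L} {Ψ : S → K} (hf : ∀ α, f (v α) = Ψ α • v α) :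
    f x = (∏ α, Ψ α ^ e α) • x := by
  induction h with
  | gen α => rw [hf, prod_pow_single]
  | ad α _ ih =>
    rw [LieHom.map_lie, hf, ih, smul_lie, lie_smul, smul_smul]
    simp only [Pi.add_apply, pow_add, Finset.prod_mul_distrib, prod_pow_single, mul_comm]

theorem sum_add_single [Fintype S] (e : S → ℕ) (α : S) :
    ∑ β, (e + Pi.single α 1 : S → ℕ) β = ∑ β, e β + 1 := by
  simp [Finset.sum_add_distrib]

theorem IsBracketMonomial.mem_lowerCentralSeries [Fintype S] (h : IsBracketMonomial v e x) {n : ℕ}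
    (hn : n < ∑ α, e α) : x ∈ LieModule.lowerCentralSeries K L L n := by
  induction h generalizing n with
  | gen α =>
    obtain rfl : n = 0 := by simpa using hn
    simp
  | ad α _ ih =>
    cases n with
    | zero => simp
    | succ n =>
      rw [sum_add_single] at hn
      rw [LieModule.lowerCentralSeries_succ]
      exact LieSubmodule.lie_mem_lie (LieSubmodule.mem_top _) (ih (by omega))

/-- A vertex without neighbours in the support of a bracket monomial commutes with it. The vertex
may itself lie in the support. -/
theorem IsBracketMonomial.lie_eq_zero {G : SimpleGraph S}
    (hv : ∀ α β, ¬ G.Adj α β → ⁅v α, v β⁆ = 0) (h : IsBracketMonomial v e x) {α : S}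
    (hα : ∀ β, e β ≠ 0 → ¬ G.Adj α β) : ⁅v α, x⁆ = 0 := by
  induction h with
  | gen β => exact hv _ _ (hα β (by simp))
  | ad β _ ih =>
    rw [leibniz_lie, hv _ _ (hα β (by simp)), ih (fun γ hγ => hα γ (by simp [hγ]))]
    simp

theorem support_add_single (e : S → ℕ) (α : S) :
    Function.support (e + Pi.single α 1) = insert α (Function.support e) := by
  ext β
  by_cases h : β = α <;> simp [h]

/-- In a nonzero bracket monomial every vertex but the innermost is adjacent to some vertex further
inside, by `IsBracketMonomial.lie_eq_zero`. -/
theorem IsBracketMonomial.support_connected [Finite S] {G : SimpleGraph S}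
    (hv : ∀ α β, ¬ G.Adj α β → ⁅v α, v β⁆ = 0) (h : IsBracketMonomial v e x) (hx : x ≠ 0) :
    (G.induce (Function.support e)).Connected ∧
      ((∃ α, e = Pi.single α 1) ∨ 2 ≤ (Function.support e).ncard) := by
  induction h with
  | gen α =>
    refine ⟨?_, Or.inl ⟨α, rfl⟩⟩
    have : Function.support (Pi.single α 1 : S → ℕ) = {α} := by
      ext β; simp
    rw [this]
    exact (SimpleGraph.connected_iff _).2 ⟨.of_subsingleton, inferInstance⟩
  | @ad α e y hy ih =>
    have hy0 : y ≠ 0 := fun h0 => hx (by rw [h0, lie_zero])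
    obtain ⟨β, hβ, hadj⟩ : ∃ β, e β ≠ 0 ∧ G.Adj α β := by
      by_contra! hcon
      exact hx (hy.lie_eq_zero hv hcon)
    rw [support_add_single]
    refine ⟨?_, Or.inr ?_⟩
    · have h1 := SimpleGraph.induce_union_connected
        (SimpleGraph.induce_pair_connected_of_adj hadj).preconnected (ih hy0).1.preconnected
        ⟨β, by simp, hβ⟩
      have h2 : ({α, β} : Set S) ∪ Function.support e = insert α (Function.support e) := by
        ext γ
        simp only [Set.mem_union, Set.mem_insert_iff, Set.mem_singleton_iff, Function.mem_support]
        constructor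
        · rintro ((h | rfl) | h) <;> tauto
        · tauto
      rwa [h2] at h1
    · rw [← Set.ncard_pair hadj.ne]
      exact Set.ncard_le_ncard (Set.insert_subset_insert (by simpa using hβ)) (Set.toFinite _)

/-- If `v` generates the Lie algebra, the bracket monomials span it: their span is stable under
`ad (v α)` for all `α`, hence under `ad y` for all `y`, so it is a Lie subalgebra. -/
theorem span_isBracketMonomial_eq_top
    (hv : ∀ H : LieSubalgebra K L, (∀ α, v α ∈ H) → H = ⊤) :
    Submodule.span K {x | ∃ e, IsBracketMonomial v e x} = ⊤ := by
  set U := Submodule.span K {x | ∃ e, IsBracketMonomial v e x} with hU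
  let H : LieSubalgebra K L :=
    { carrier := {y | ∀ x ∈ U, ⁅y, x⁆ ∈ U}
      add_mem' := fun {y z} hy hz x hx => by rw [add_lie]; exact U.add_mem (hy x hx) (hz x hx)
      zero_mem' := fun x _ => by rw [zero_lie]; exact U.zero_mem
      smul_mem' := fun a y hy x hx => by rw [smul_lie]; exact U.smul_mem a (hy x hx)
      lie_mem' := fun {y z} hy hz x hx => by
        rw [lie_lie]; exact U.sub_mem (hy _ (hz x hx)) (hz _ (hy x hx)) }
  have hH : H = ⊤ := hv H fun α x hx => by
    induction hx using Submodule.span_induction with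
    | mem x hx => obtain ⟨e, he⟩ := hx; exact Submodule.subset_span ⟨_, he.ad α⟩
    | zero => rw [lie_zero]; exact U.zero_mem
    | add x y _ _ hx hy => rw [lie_add]; exact U.add_mem hx hy
    | smul a x _ hx => rw [lie_smul]; exact U.smul_mem a hx
  let H' : LieSubalgebra K L :=
    { U with
      lie_mem' := fun {y z} _ hz => (hH ▸ LieSubalgebra.mem_top y : y ∈ H) z hz }
  have hH' : H' = ⊤ := hv H' fun α => Submodule.subset_span ⟨_, .gen α⟩
  exact (Submodule.eq_top_iff').2 fun x => (hH' ▸ LieSubalgebra.mem_top x : x ∈ H')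

end Monomials

/-! ### Generators and relations -/

section Generators

variable {K : Type*} [Field K] {S : Type*} {G : SimpleGraph S} {c : ℕ}

theorem lie_vertex_eq_zero {α β : S} (h : ¬ G.Adj α β) :
    ⁅vertex K G c α, vertex K G c β⁆ = 0 := by
  have h1 : (LieSubmodule.Quotient.mk ⁅FreeLieAlgebra.of K α, FreeLieAlgebra.of K β⁆ :
      FreePartComm K G) = 0 :=
    (Submodule.Quotient.mk_eq_zero _).2 (LieSubmodule.subset_lieSpan ⟨α, β, h, rfl⟩)
  change (LieSubmodule.Quotient.mk (LieSubmodule.Quotient.mk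
    ⁅FreeLieAlgebra.of K α, FreeLieAlgebra.of K β⁆ : FreePartComm K G) : NilpotentLie K G c) = 0
  rw [h1]
  rfl

/-- The quotient map `𝔤_G → 𝔫_{G,c}`. -/
def toNilpotent (K : Type*) [Field K] {S : Type*} (G : SimpleGraph S) (c : ℕ) :
    FreePartComm K G →ₗ⁅K⁆ NilpotentLie K G c :=
  { (gammaSucc K G c).toSubmodule.mkQ with map_lie' := fun {_ _} => rfl }

/-- The quotient map from the free Lie algebra to `𝔤_G`. -/
def toFreePartComm (K : Type*) [Field K] {S : Type*} (G : SimpleGraph S) :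
    FreeLieAlgebra K S →ₗ⁅K⁆ FreePartComm K G :=
  { (nonEdgeIdeal K G).toSubmodule.mkQ with map_lie' := fun {_ _} => rfl }

/-- The element of `𝔤_G` given by a vertex of `G`. -/
def freeVertex (K : Type*) [Field K] {S : Type*} (G : SimpleGraph S) (α : S) : FreePartComm K G :=
  toFreePartComm K G (FreeLieAlgebra.of K α)

theorem toNilpotent_eq_zero {x : FreePartComm K G} :
    toNilpotent K G c x = 0 ↔ x ∈ gammaSucc K G c :=
  Submodule.Quotient.mk_eq_zero _

theorem eq_top_of_freeVertex_mem (H : LieSubalgebra K (FreePartComm K G))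
    (hH : ∀ α, freeVertex K G α ∈ H) : H = ⊤ := by
  let g : FreeLieAlgebra K S →ₗ⁅K⁆ H := FreeLieAlgebra.lift K fun α => ⟨_, hH α⟩
  have key : H.incl.comp g = toFreePartComm K G := FreeLieAlgebra.hom_ext fun α => by
    rw [LieHom.comp_apply, FreeLieAlgebra.lift_of_apply]; rfl
  refine eq_top_iff.2 fun x _ => ?_
  induction x using Submodule.Quotient.induction_on with | _ x
  change toFreePartComm K G x ∈ H
  rw [← LieHom.congr_fun key x]
  exact (g x).2

theorem eq_top_of_vertex_mem (H : LieSubalgebra K (NilpotentLie K G c))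
    (hH : ∀ α, vertex K G c α ∈ H) : H = ⊤ := by
  have h1 := eq_top_of_freeVertex_mem (H.comap (toNilpotent K G c)) hH
  refine eq_top_iff.2 fun x _ => ?_
  induction x using Submodule.Quotient.induction_on with | _ x
  have : x ∈ H.comap (toNilpotent K G c) := h1 ▸ LieSubalgebra.mem_top x
  exact this

theorem IsBracketMonomial.eq_zero_of_lt_sum [Fintype S] [DecidableEq S] {e : S → ℕ}
    {x : NilpotentLie K G c} (h : IsBracketMonomial (vertex K G c) e x) (hlt : c < ∑ α, e α) :
    x = 0 := by
  have h1 := h.mem_lowerCentralSeries (K := K) hlt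
  rw [← LieIdeal.lowerCentralSeries_map_eq c (f := toNilpotent K G c)
    (Submodule.Quotient.mk_surjective _)] at h1
  have h2 : (gammaSucc K G c).map (toNilpotent K G c) ≤ ⊥ := by
    rw [LieIdeal.map_le]
    rintro _ ⟨y, hy, rfl⟩
    exact toNilpotent_eq_zero.2 hy
  exact (LieSubmodule.mem_bot _).1 (h2 h1)

end Generators

/-! ### Representations by weighted shifts -/

section Representation

attribute [local instance] LieRing.ofAssociativeRing

variable {K : Type*} [Field K] {S : Type*} [DecidableEq S]

/-- The weighted shift operator `F ↦ (e ↦ φ e * F (e + 1_α))` on functions of a multidegree. -/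
def weightedShift (φ : (S → ℕ) → K) (α : S) : Module.End K ((S → ℕ) → K) where
  toFun F e := φ e * F (e + Pi.single α 1)
  map_add' F F' := by ext e; simp [mul_add]
  map_smul' a F := by ext e; simp [mul_left_comm]

@[simp]
theorem weightedShift_apply (φ : (S → ℕ) → K) (α : S) (F : (S → ℕ) → K) (e : S → ℕ) :
    weightedShift φ α F e = φ e * F (e + Pi.single α 1) := rfl

/-- If the weight of each vertex does not depend on the multiplicities of its non-neighbours (the
vertex itself included), the weighted shifts commute for non-adjacent vertices, and so they
define a representation of `𝔤_G`. -/
theorem exists_shift_representation (G : SimpleGraph S) (φ : S → (S → ℕ) → K)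
    (hφ : ∀ α β, ¬ G.Adj α β → ∀ e, φ α (e + Pi.single β 1) = φ α e) :
    ∃ ρ : FreePartComm K G →ₗ⁅K⁆ Module.End K ((S → ℕ) → K),
      ∀ α, ρ (freeVertex K G α) = weightedShift (φ α) α := by
  let ρ₀ : FreeLieAlgebra K S →ₗ⁅K⁆ Module.End K ((S → ℕ) → K) :=
    FreeLieAlgebra.lift K fun α => weightedShift (φ α) α
  have hρ₀ : ∀ α, ρ₀ (FreeLieAlgebra.of K α) = weightedShift (φ α) α :=
    fun α => FreeLieAlgebra.lift_of_apply _ α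
  have h₀ : nonEdgeIdeal K G ≤ ρ₀.ker := by
    rw [LieSubmodule.lieSpan_le]
    rintro _ ⟨α, β, hab, rfl⟩
    rw [SetLike.mem_coe, LieHom.mem_ker, LieHom.map_lie, hρ₀, hρ₀]
    ext F e
    rw [Ring.lie_def]
    simp only [LinearMap.sub_apply, Module.End.mul_apply, Pi.sub_apply, weightedShift_apply,
      hφ α β hab, hφ β α (fun h => hab h.symm), LinearMap.zero_apply, Pi.zero_apply,
      add_right_comm e (Pi.single β 1)]
    ring
  obtain ⟨ρ, hρ⟩ := exists_quotient_lift (nonEdgeIdeal K G) ρ₀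
    (fun x hx => LieHom.mem_ker.1 (h₀ hx))
  exact ⟨ρ, fun α => (hρ _).trans (hρ₀ α)⟩

variable [Fintype S]

/-- The operators on functions of a multidegree that lower the total degree by at least `n`:
they map every function vanishing in total degrees `≥ k` to one vanishing in total degrees
`≥ k - n`. -/
def lowering (K S : Type*) [Field K] [Fintype S] (n : ℕ) :
    Submodule K (Module.End K ((S → ℕ) → K)) where
  carrier := {T | ∀ (F : (S → ℕ) → K) (k : ℕ), (∀ e, k ≤ ∑ α, e α → F e = 0) →
    ∀ e, k ≤ ∑ α, e α + n → T F e = 0}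
  add_mem' hT hU F k hF e he := by simp [hT F k hF e he, hU F k hF e he]
  zero_mem' F k _ e _ := rfl
  smul_mem' a T hT F k hF e he := by simp [hT F k hF e he]

omit [DecidableEq S] in
theorem mul_mem_lowering {T U : Module.End K ((S → ℕ) → K)} {m n k : ℕ} (hT : T ∈ lowering K S m)
    (hU : U ∈ lowering K S n) (hk : k ≤ m + n) : T * U ∈ lowering K S k := fun F l hF e he =>
  hT (U F) (l - n) (fun e' he' => hU F l hF e' (by omega)) e (by omega)

omit [DecidableEq S] in
theorem lie_mem_lowering {T U : Module.End K ((S → ℕ) → K)} {m n k : ℕ} (hT : T ∈ lowering K S m)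
    (hU : U ∈ lowering K S n) (hk : k ≤ m + n) : ⁅T, U⁆ ∈ lowering K S k :=
  Submodule.sub_mem _ (mul_mem_lowering hT hU hk) (mul_mem_lowering hU hT (by omega))

theorem weightedShift_mem_lowering (φ : (S → ℕ) → K) (α : S) :
    weightedShift φ α ∈ lowering K S 1 := fun F k hF e he => by
  rw [weightedShift_apply, hF _ (by rwa [sum_add_single]), mul_zero]

theorem lowering_of_mem_gammaSucc {G : SimpleGraph S} {φ : S → (S → ℕ) → K}
    {ρ : FreePartComm K G →ₗ⁅K⁆ Module.End K ((S → ℕ) → K)}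
    (hρ : ∀ α, ρ (freeVertex K G α) = weightedShift (φ α) α)
    (c : ℕ) {x : FreePartComm K G} (hx : x ∈ gammaSucc K G c) : ρ x ∈ lowering K S (c + 1) := by
  let H : LieSubalgebra K (FreePartComm K G) :=
    { (lowering K S 1).comap (ρ : FreePartComm K G →ₗ[K] Module.End K ((S → ℕ) → K)) with
      lie_mem' := fun {y z} hy hz => by
        change ρ ⁅y, z⁆ ∈ lowering K S 1
        rw [LieHom.map_lie]
        exact lie_mem_lowering hy hz (by omega) }
  have hH : H = ⊤ := eq_top_of_freeVertex_mem H fun α => by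
    change ρ _ ∈ lowering K S 1
    rw [hρ]
    exact weightedShift_mem_lowering _ _
  have h1 : ∀ y, ρ y ∈ lowering K S 1 := fun y => (hH ▸ LieSubalgebra.mem_top y : y ∈ H)
  induction c generalizing x with
  | zero => exact h1 x
  | succ c ih =>
    rw [gammaSucc, LieModule.lowerCentralSeries_succ, ← LieSubmodule.mem_toSubmodule,
      LieSubmodule.lieIdeal_oper_eq_linear_span'] at hx
    induction hx using Submodule.span_induction with
    | mem x hx =>
      obtain ⟨y, _, z, hz, rfl⟩ := hx
      rw [LieHom.map_lie]
      exact lie_mem_lowering (h1 y) (ih hz) (by omega)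
    | zero => rw [map_zero]; exact Submodule.zero_mem _
    | add x y _ _ hx hy => rw [map_add]; exact Submodule.add_mem _ hx hy
    | smul a x _ hx => rw [map_smul]; exact Submodule.smul_mem _ a hx

/-- An element of `𝔤_G` which a shift representation sends to an operator with a nonzero matrix
coefficient between the multidegrees `0` and `e` is nonzero modulo `γ_{c+1}` for `c ≥ |e|`. -/
theorem toNilpotent_ne_zero {G : SimpleGraph S} {φ : S → (S → ℕ) → K}
    {ρ : FreePartComm K G →ₗ⁅K⁆ Module.End K ((S → ℕ) → K)}
    (hρ : ∀ α, ρ (freeVertex K G α) = weightedShift (φ α) α)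
    {c : ℕ} {e : S → ℕ} (he : ∑ α, e α ≤ c) {x : FreePartComm K G} {s : K} (hs : s ≠ 0)
    (hx : ∀ F, ρ x F 0 = s * F e) : toNilpotent K G c x ≠ 0 := by
  classical
  intro h
  refine hs ?_
  have := lowering_of_mem_gammaSucc hρ c (toNilpotent_eq_zero.1 h) (Pi.single e 1) (∑ α, e α + 1)
    (fun e' he' => Pi.single_eq_of_ne (by rintro rfl; omega) _) 0 (by simpa using he)
  rwa [hx, Pi.single_eq_same, mul_one] at this

theorem vertex_ne_zero {G : SimpleGraph S} {c : ℕ} (hc : 1 ≤ c) (α : S) :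
    vertex K G c α ≠ 0 := by
  -- With all weights one the shifts commute, and the vertex `α` acts by a nonzero operator.
  obtain ⟨ρ, hρ⟩ := exists_shift_representation (K := K) G (fun _ _ => 1) (fun _ _ _ _ => rfl)
  exact toNilpotent_ne_zero hρ (e := Pi.single α 1) (s := 1) (by simpa using hc) one_ne_zero
    (x := freeVertex K G α) (fun F => by rw [hρ]; simp)

end Representation

/-! ### Nonzero bracket monomials with prescribed multidegree -/

section Nonvanishing

attribute [local instance] LieRing.ofAssociativeRing

variable {K : Type*} [Field K] {S : Type*} [DecidableEq S]

open Classical in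
/-- The weights, attached to an edge `a b`, that single out one word in the expansion of a bracket
monomial built on `[a, […, [a, b]]]`. A word is read from the left, starting in multidegree `0` and
recording the multidegree `e` read so far; the letter `a` has weight one as long as `b` has not been
read, every other letter as soon as one of its neighbours has been read. -/
def edgeWeight (K : Type*) [Field K] {S : Type*} (G : SimpleGraph S) (a b α : S) (e : S → ℕ) : K :=
  if α = a then (if e b = 0 then 1 else 0) else if ∃ β, G.Adj α β ∧ e β ≠ 0 then 1 else 0

theorem edgeWeight_add_single {G : SimpleGraph S} {a b α β : S} (hab : G.Adj a b)
    (h : ¬ G.Adj α β) (e : S → ℕ) :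
    edgeWeight K G a b α (e + Pi.single β 1) = edgeWeight K G a b α e := by
  have key : ∀ γ, γ ≠ β → (e + Pi.single β 1 : S → ℕ) γ = e γ := fun γ hγ => by
    simp [Pi.single_eq_of_ne hγ]
  have hadj : (∃ γ, G.Adj α γ ∧ (e + Pi.single β 1 : S → ℕ) γ ≠ 0) ↔
      ∃ γ, G.Adj α γ ∧ e γ ≠ 0 := by
    refine exists_congr fun γ => and_congr_right fun hγ => ?_
    rw [key γ (by rintro rfl; exact h hγ)]
  by_cases h1 : α = a
  · rw [edgeWeight, edgeWeight, if_pos h1, if_pos h1, key b (by rintro rfl; exact h (h1 ▸ hab))]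
  · rw [edgeWeight, edgeWeight, if_neg h1, if_neg h1]
    by_cases h2 : ∃ γ, G.Adj α γ ∧ e γ ≠ 0
    · rw [if_pos h2, if_pos (hadj.2 h2)]
    · rw [if_neg h2, if_neg (mt hadj.1 h2)]

variable {G : SimpleGraph S} {a b : S}
  {ρ : FreePartComm K G →ₗ⁅K⁆ Module.End K ((S → ℕ) → K)}

/-- The monomial `ad(a)^m b`: among the words in its expansion only `a^m b` has nonzero weight when
read from a multidegree that is a multiple of `a`. -/
theorem exists_monomial_ad_pow (hab : G.Adj a b)
    (hρ : ∀ α, ρ (freeVertex K G α) = weightedShift (edgeWeight K G a b α) α) (m : ℕ) :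
    ∃ x, IsBracketMonomial (freeVertex K G) (Pi.single a m + Pi.single b 1) x ∧
      ∀ (F : (S → ℕ) → K) (i : ℕ), ρ x F (Pi.single a i) =
        if i + m = 0 then 0 else F (Pi.single a (i + m) + Pi.single b 1) := by
  induction m with
  | zero =>
    refine ⟨freeVertex K G b, ?_, fun F i => ?_⟩
    · simpa using IsBracketMonomial.gen (v := freeVertex K G) b
    · have : (∃ β, G.Adj b β ∧ (Pi.single a i : S → ℕ) β ≠ 0) ↔ ¬ i = 0 := by
        constructor
        · rintro ⟨β, _, h⟩ rfl
          simp at h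
        · exact fun h => ⟨a, hab.symm, by simpa using h⟩
      rw [hρ, weightedShift_apply, edgeWeight, if_neg hab.ne', add_zero]
      simp only [this]
      split_ifs <;> simp
  | succ m ih =>
    obtain ⟨x, hx, hF⟩ := ih
    refine ⟨⁅freeVertex K G a, x⁆, ?_, fun F i => ?_⟩
    · have := hx.ad a
      rwa [add_right_comm, ← Pi.single_add] at this
    · -- A letter `a` read after the letter `b` has weight zero.
      have h1 : ∀ j, edgeWeight K G a b a (Pi.single a j + Pi.single b 1) = 0 := fun j => by
        simp [edgeWeight]
      have h2 : edgeWeight K G a b a (Pi.single a i) = 1 := by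
        simp [edgeWeight, Pi.single_eq_of_ne hab.ne']
      rw [LieHom.map_lie, Ring.lie_def, hρ]
      simp only [LinearMap.sub_apply, Module.End.mul_apply, Pi.sub_apply]
      rw [weightedShift_apply, ← Pi.single_add, h2, hF, hF, weightedShift_apply, h1,
        zero_mul, ite_self, one_mul, sub_zero, if_neg (by omega), if_neg (by omega),
        add_right_comm i 1 m, add_assoc i m 1]

/-- A bracket monomial with nonzero matrix coefficient stays so after a bracket with a vertex
`α ≠ a` adjacent to its support: since `α` has weight zero in multidegree `0`, only one of the two
terms of the commutator contributes. -/
theorem exists_monomial_add_single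
    (hρ : ∀ α, ρ (freeVertex K G α) = weightedShift (edgeWeight K G a b α) α) {e : S → ℕ}
    {α β : S} (hα : α ≠ a) (hαβ : G.Adj α β) (hβ : e β ≠ 0)
    (h : ∃ x, IsBracketMonomial (freeVertex K G) e x ∧ ∃ s : K, s ≠ 0 ∧ ∀ F, ρ x F 0 = s * F e) :
    ∃ x, IsBracketMonomial (freeVertex K G) (e + Pi.single α 1) x ∧
      ∃ s : K, s ≠ 0 ∧ ∀ F, ρ x F 0 = s * F (e + Pi.single α 1) := by
  obtain ⟨x, hx, s, hs, hF⟩ := h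
  refine ⟨⁅freeVertex K G α, x⁆, hx.ad α, -s, neg_ne_zero.2 hs, fun F => ?_⟩
  have h0 : edgeWeight K G a b α 0 = 0 := by simp [edgeWeight, hα]
  have h1 : edgeWeight K G a b α e = 1 := by
    rw [edgeWeight, if_neg hα, if_pos ⟨β, hαβ, hβ⟩]
  rw [LieHom.map_lie, Ring.lie_def, hρ]
  simp only [LinearMap.sub_apply, Module.End.mul_apply, Pi.sub_apply]
  rw [weightedShift_apply, h0, hF, weightedShift_apply, h1]
  ring

variable [Fintype S]

/-- Starting from the monomial `ad(a)^m b` with `m = e a`, every multidegree `e` with connected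
support containing the edge `a b` is reached by adding vertices other than `a`, each adjacent to the
support reached so far. -/
theorem exists_monomial_of_connected (hab : G.Adj a b)
    (hρ : ∀ α, ρ (freeVertex K G α) = weightedShift (edgeWeight K G a b α) α) {e : S → ℕ}
    (he : (G.induce (Function.support e)).Connected) (ha : e a ≠ 0) (hb : e b ≠ 0) :
    ∃ x, IsBracketMonomial (freeVertex K G) e x ∧ ∃ s : K, s ≠ 0 ∧ ∀ F, ρ x F 0 = s * F e := by
  suffices key : ∀ (n : ℕ) (d : S → ℕ), ∑ α, e α = ∑ α, d α + n → d ≤ e → d a = e a →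
      (∀ α, d α ≠ 0 → ∃ β, G.Adj α β ∧ d β ≠ 0) →
      (∃ x, IsBracketMonomial (freeVertex K G) d x ∧ ∃ s : K, s ≠ 0 ∧ ∀ F, ρ x F 0 = s * F d) →
      ∃ x, IsBracketMonomial (freeVertex K G) e x ∧ ∃ s : K, s ≠ 0 ∧ ∀ F, ρ x F 0 = s * F e by
    have hle : Pi.single a (e a) + Pi.single b 1 ≤ e := fun α => by
      rcases eq_or_ne α a with rfl | h1
      · simp [Pi.single_eq_of_ne hab.ne]
      · rcases eq_or_ne α b with rfl | h2
        · simpa [Pi.single_eq_of_ne h1] using Nat.one_le_iff_ne_zero.2 hb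
        · simp [Pi.single_eq_of_ne h1, Pi.single_eq_of_ne h2]
    refine key _ (Pi.single a (e a) + Pi.single b 1)
      (Nat.add_sub_cancel' (Finset.sum_le_sum fun α _ => hle α)).symm hle
      (by simp [Pi.single_eq_of_ne hab.ne]) (fun α hα => ?_) ?_
    · rcases eq_or_ne α a with rfl | h1
      · exact ⟨b, hab, by simp⟩
      · rcases eq_or_ne α b with rfl | h2
        · exact ⟨a, hab.symm, by simpa using fun h => absurd h ha⟩
        · simp [Pi.single_eq_of_ne h1, Pi.single_eq_of_ne h2] at hα
    · obtain ⟨x, hx, hF⟩ := exists_monomial_ad_pow hab hρ (e a)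
      refine ⟨x, hx, 1, one_ne_zero, fun F => ?_⟩
      have := hF F 0
      rwa [Pi.single_zero, zero_add, if_neg ha, ← one_mul (F _)] at this
  intro n
  induction n with
  | zero =>
    intro d hsum hle _ _ hd
    have : d = e := funext fun α =>
      (Finset.sum_eq_sum_iff_of_le fun α _ => hle α).1 (by omega) α (Finset.mem_univ α)
    exact this ▸ hd
  | succ n ih =>
    intro d hsum hle hda hnb hd
    obtain ⟨α, β, hα, hadj, hβ⟩ : ∃ α β, d α < e α ∧ G.Adj α β ∧ d β ≠ 0 := by
      by_cases hsupp : ∀ α, e α ≠ 0 → d α ≠ 0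
      · obtain ⟨α, -, hα⟩ : ∃ α ∈ Finset.univ, d α < e α :=
          Finset.exists_lt_of_sum_lt (by omega)
        obtain ⟨β, h⟩ := hnb α (hsupp α (by omega))
        exact ⟨α, β, hα, h⟩
      · -- A walk in the support of `e` that leaves the support of `d`.
        push Not at hsupp
        obtain ⟨α, hα, hdα⟩ := hsupp
        obtain ⟨p⟩ := he.preconnected ⟨a, ha⟩ ⟨α, hα⟩
        obtain ⟨t, -, h1, h2⟩ := p.exists_boundary_dart {γ | d γ ≠ 0}
          (by simpa [hda] using ha) (by simpa using hdα)
        have h3 : e t.snd ≠ 0 := t.snd.2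
        have h4 : d t.snd = 0 := by simpa using h2
        exact ⟨t.snd, t.fst, by omega, (SimpleGraph.induce_adj.1 t.adj).symm, h1⟩
    have hαa : α ≠ a := by rintro rfl; omega
    refine ih (d + Pi.single α 1) (by rw [sum_add_single]; omega) (fun γ => ?_) ?_ (fun γ hγ => ?_)
      (exists_monomial_add_single hρ hαa hadj hβ hd)
    · rcases eq_or_ne γ α with rfl | h
      · simpa using hα
      · simpa [Pi.single_eq_of_ne h] using hle γ
    · simp [Pi.single_eq_of_ne hαa.symm, hda]
    · rcases eq_or_ne γ α with rfl | h
      · exact ⟨β, hadj, by simp [hβ]⟩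
      · obtain ⟨δ, h1, h2⟩ := hnb γ (by simpa [Pi.single_eq_of_ne h] using hγ)
        exact ⟨δ, h1, by simp [h2]⟩

/-- Every multidegree of total degree at most `c` whose support is connected and has at least two
vertices is the multidegree of a nonzero bracket monomial in `𝔫_{G,c}`. -/
theorem exists_monomial_ne_zero {c : ℕ} {e : S → ℕ}
    (he : (G.induce (Function.support e)).Connected) (h2 : 2 ≤ (Function.support e).ncard)
    (hc : ∑ α, e α ≤ c) :
    ∃ x : NilpotentLie K G c, IsBracketMonomial (vertex K G c) e x ∧ x ≠ 0 := by
  have : Nontrivial (Function.support e) :=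
    Set.nontrivial_coe_sort.2 ((Set.one_lt_ncard_iff_nontrivial).1 h2)
  obtain ⟨a⟩ := he.nonempty
  obtain ⟨b, hab⟩ := he.preconnected.exists_adj_of_nontrivial a
  rw [SimpleGraph.induce_adj] at hab
  obtain ⟨ρ, hρ⟩ := exists_shift_representation G (edgeWeight K G a b)
    (fun _ _ h e => edgeWeight_add_single hab h e)
  obtain ⟨x, hx, s, hs, hF⟩ := exists_monomial_of_connected hab hρ he a.2 b.2
  exact ⟨_, hx.map (toNilpotent K G c), toNilpotent_ne_zero hρ hc hs hF⟩

end Nonvanishing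

/-! ### Eigenvalues -/

section Eigenvalues

variable {K : Type*} [Field K] {S : Type*} [Fintype S] {G : SimpleGraph S} {c : ℕ}

/-- The eigenvalues of a vertex-diagonal endomorphism, over an arbitrary field. -/
theorem eigenvalues_eq (hc : 1 ≤ c) {Ψ : S → K} {f : NilpotentLie K G c →ₗ⁅K⁆ NilpotentLie K G c}
    (hf : ∀ α, f (vertex K G c α) = Ψ α • vertex K G c α) :
    {μ : K | Module.End.HasEigenvalue (f : Module.End K (NilpotentLie K G c)) μ} =
      Set.range Ψ ∪
        {μ : K | ∃ e : S → ℕ, (G.induce (Function.support e)).Connected ∧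
          2 ≤ (Function.support e).ncard ∧ ∑ α, e α ≤ c ∧ μ = ∏ α, Ψ α ^ e α} := by
  classical
  apply Set.Subset.antisymm
  · intro μ hμ
    by_contra hcon
    -- All nonzero bracket monomials lie in eigenspaces to eigenvalues other than `μ`.
    have hspan : (⊤ : Submodule K (NilpotentLie K G c)) ≤
        ⨆ ν, ⨆ _ : ν ≠ μ, Module.End.eigenspace (f : Module.End K (NilpotentLie K G c)) ν := by
      rw [← span_isBracketMonomial_eq_top (K := K) (v := vertex K G c) eq_top_of_vertex_mem,
        Submodule.span_le]
      rintro x ⟨e, hx⟩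
      by_cases hx0 : x = 0
      · rw [hx0]; exact Submodule.zero_mem _
      have hfx := hx.apply_eq_prod_smul hf
      refine Submodule.mem_iSup_of_mem (∏ α, Ψ α ^ e α) (Submodule.mem_iSup_of_mem ?_
        (Module.End.mem_eigenspace_iff.2 hfx))
      rintro rfl
      obtain ⟨hconn, ⟨α, rfl⟩ | h2⟩ :=
        hx.support_connected (fun _ _ h => lie_vertex_eq_zero h) hx0
      · exact hcon (Or.inl ⟨α, (prod_pow_single Ψ α).symm⟩)
      · exact hcon (Or.inr ⟨e, hconn, h2, not_lt.1 fun hlt => hx0 (hx.eq_zero_of_lt_sum hlt), rfl⟩)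
    have hdisj := Module.End.eigenspaces_iSupIndep (f : Module.End K (NilpotentLie K G c)) μ
    exact hμ (disjoint_top.1 (hdisj.mono_right hspan))
  · rintro μ (⟨α, rfl⟩ | ⟨e, he, h2, hsum, rfl⟩)
    · exact Module.End.hasEigenvalue_of_hasEigenvector
        ⟨Module.End.mem_eigenspace_iff.2 (hf α), vertex_ne_zero hc α⟩
    · obtain ⟨x, hx, hx0⟩ := exists_monomial_ne_zero (K := K) he h2 hsum
      exact Module.End.hasEigenvalue_of_hasEigenvector
        ⟨Module.End.mem_eigenspace_iff.2 (hx.apply_eq_prod_smul hf), hx0⟩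

end Eigenvalues

end GraphLie

end

theorem mainTheorem12 {S : Type*} [Fintype S] (G : SimpleGraph S) (K : Subfield ℂ)
    (c : ℕ) (hc : 1 ≤ c) (Ψ : S → K)
    (f : GraphLie.NilpotentLie K G c ≃ₗ⁅K⁆ GraphLie.NilpotentLie K G c)
    (hf : GraphLie.IsVertexDiagonal f Ψ) :
    {μ : K | Module.End.HasEigenvalue
        ((f : GraphLie.NilpotentLie K G c →ₗ⁅K⁆ GraphLie.NilpotentLie K G c) :
          Module.End K (GraphLie.NilpotentLie K G c)) μ} =
      Set.range Ψ ∪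
        {μ : K | ∃ e : S → ℕ, (G.induce (Function.support e)).Connected ∧
          2 ≤ (Function.support e).ncard ∧ ∑ α, e α ≤ c ∧ μ = ∏ α, Ψ α ^ e α} :=
  GraphLie.eigenvalues_eq hc hf
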